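/- Let $d$ be a natural number and let $\mathcal{K}_d$ be the set of $d$-dimensional convex bodies, i.e. of convex compact subsets of $\mathbb{R}^d$ with non-empty interior, equipped with the Hausdorff distance. Let $\mathcal{AT}_d$ be the set of invertible affine maps $\mathbb{R}^d\to\mathbb{R}^d$. For $K\in\mathcal{K}_d$ put $$\mathfrak{F}_d(K)=\{x\in\mathbb{R}^d : T(x)=x \text{ for every } T\in\mathcal{AT}_d \text{ with } T(K)=K\}.$$ An affine point is a map $p:\mathcal{K}_d\to\mathbb{R}^d$ which is continuous with respect to the Hausdorff distance and the Euclidean norm and satisfies $p(T(C))=T(p(C))$ for every $C\in\mathcal{K}_d$ and every $T\in\mathcal{AT}_d$. It is called proper if $p(C)\in\mathrm{int}(C)$ for every $C\in\mathcal{K}_d$. Let $K\in\mathcal{K}_d$ and $x_0\in\mathfrak{F}_d(K)\cap\mathrm{int}(K)$. Then there is a proper affine point $p$ with $p(K)=x_0$. -/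

import Mathlib

namespace AffinePoints

/-- The set of `d`-dimensional convex bodies: convex compact subsets of Euclidean `ℝ^d` with
non-empty interior. As a subtype of Mathlib's `ConvexBody`, it carries the Hausdorff distance. -/
abbrev FullBody (d : ℕ) : Type :=
  {C : ConvexBody (EuclideanSpace ℝ (Fin d)) // (interior (C : Set (EuclideanSpace ℝ (Fin d)))).Nonempty}

/-- The underlying set of points of a `d`-dimensional convex body. -/
def FullBody.toSet {d : ℕ} (C : FullBody d) : Set (EuclideanSpace ℝ (Fin d)) :=
  (C.1 : Set (EuclideanSpace ℝ (Fin d)))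

theorem continuous_affineEquiv {d : ℕ}
    (T : EuclideanSpace ℝ (Fin d) ≃ᵃ[ℝ] EuclideanSpace ℝ (Fin d)) : Continuous T :=
  T.toAffineMap.continuous_of_finiteDimensional

/-- The image `T(C)` of a `d`-dimensional convex body under an invertible affine map. -/
def FullBody.map {d : ℕ} (T : EuclideanSpace ℝ (Fin d) ≃ᵃ[ℝ] EuclideanSpace ℝ (Fin d))
    (C : FullBody d) : FullBody d :=
  ⟨{ carrier := T '' C.toSet
     convex' := C.1.convex.affine_image T.toAffineMap
     isCompact' := C.1.isCompact.image (continuous_affineEquiv T)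
     nonempty' := C.1.nonempty.image T }, by
    have hpre : IsOpen (T.symm ⁻¹' interior C.toSet) :=
      isOpen_interior.preimage (continuous_affineEquiv T.symm)
    obtain ⟨x, hx⟩ := C.2
    refine ⟨T x, interior_maximal ?_ hpre ?_⟩
    · intro y hy
      exact ⟨T.symm y, interior_subset hy, T.apply_symm_apply y⟩
    · change T.symm (T x) ∈ interior C.toSet
      rw [T.symm_apply_apply]
      exact hx⟩

theorem FullBody.toSet_map {d : ℕ}
    (T : EuclideanSpace ℝ (Fin d) ≃ᵃ[ℝ] EuclideanSpace ℝ (Fin d)) (C : FullBody d) :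
    (C.map T).toSet = T '' C.toSet :=
  rfl

/-- Affine (invariant) points: maps on convex bodies that are continuous with respect to
the Hausdorff distance and equivariant under all invertible affine maps. -/
structure IsAffinePoint {d : ℕ} (p : FullBody d → EuclideanSpace ℝ (Fin d)) : Prop where
  continuous : Continuous p
  map_eq : ∀ (T : EuclideanSpace ℝ (Fin d) ≃ᵃ[ℝ] EuclideanSpace ℝ (Fin d)) (C : FullBody d),
    p (C.map T) = T (p C)

/-- Proper affine points: affine points with `p(C) ∈ int(C)` for every convex body `C`. -/
structure IsProperAffinePoint {d : ℕ} (p : FullBody d → EuclideanSpace ℝ (Fin d)) : Prop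
    extends IsAffinePoint p where
  mem_interior : ∀ C : FullBody d, p C ∈ interior C.toSet

/-- The set `F_d(C)` of points fixed by all affine symmetries of the convex body `C`. -/
def fixedPoints {d : ℕ} (C : FullBody d) : Set (EuclideanSpace ℝ (Fin d)) :=
  {x | ∀ T : EuclideanSpace ℝ (Fin d) ≃ᵃ[ℝ] EuclideanSpace ℝ (Fin d), C.map T = C → T x = x}

end AffinePoints

open Set Filter Topology Metric MeasureTheory

namespace AffinePoints

/-! ### Hausdorff-metric stability of convex bodies, and the set of affine maps sending one body
into another. -/

section Body

variable {E : Type*} [NormedAddCommGroup E] [InnerProductSpace ℝ E]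

/-! The proof corrects a non-equivariant selection by averaging over affine maps. On the orbit of
`K` the rule `T(K) ↦ T(x₀)` is well defined because `x₀` is fixed by the symmetries of `K`. It is
continuous, and the orbit is closed, because the affine group acts properly
(`isProperMap_orbitMap`). Extension off the orbit and a partition of unity give a continuous `f`
with `f(C) ∈ int C` and `f(T(K)) = T(x₀)` (`exists_continuous_selection`).

Then `p(C)` is the mean of `T(f(T⁻¹(C)))` over the affine maps `T` with `T(K) ⊆ C`, for Lebesgue
measure on pairs `(b, A)`. This set of maps is compact with nonempty interior, so the mean exists
although the affine group is not compact. Singular maps form a null set. The substitution `T ↦ S ∘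
T` scales the measure by a constant, which cancels in a mean, so `p` is equivariant. Continuity is
dominated convergence: the domain is convex, so its frontier is null. Convexity of `C` keeps `p(C)`
interior. For `C = K` the integrand is constantly `x₀`. -/

theorem exists_mem_dist_le (C D : ConvexBody E) {x : E} (hx : x ∈ C) :
    ∃ y ∈ D, dist x y ≤ dist C D := by
  obtain ⟨y, hy, h⟩ := D.isCompact.exists_infDist_eq_dist D.nonempty x
  refine ⟨y, hy, h ▸ ?_⟩
  exact infDist_le_hausdorffDist_of_mem hx ConvexBody.hausdorffEDist_ne_top

theorem dist_le_of_mem_dist {C D : ConvexBody E} {r : ℝ} (hr : 0 ≤ r)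
    (h₁ : ∀ x ∈ C, ∃ y ∈ D, dist x y ≤ r) (h₂ : ∀ x ∈ D, ∃ y ∈ C, dist x y ≤ r) :
    dist C D ≤ r :=
  hausdorffDist_le_of_mem_dist hr h₁ h₂

/-- If a convex body contains a closed ball of radius `r`, then the centre of the ball lies in
every convex body at Hausdorff distance less than `r`. -/
theorem mem_of_closedBall_subset [CompleteSpace E] {C D : ConvexBody E} {x : E} {r : ℝ}
    (hC : closedBall x r ⊆ C) (hr : dist C D < r) : x ∈ D := by
  by_contra hx
  obtain ⟨f, u, hfx, hfu⟩ := geometric_hahn_banach_point_closed D.convex D.isClosed hx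
  have hr0 : 0 < r := dist_nonneg.trans_lt hr
  set v := (InnerProductSpace.toDual ℝ E).symm f with hv
  have hf : ∀ y, f y = inner ℝ v y := fun y => by
    rw [hv, InnerProductSpace.toDual_symm_apply]
  have hv0 : 0 < ‖v‖ := by
    rw [norm_pos_iff]
    intro h0
    obtain ⟨y, hy⟩ := D.nonempty
    have h1 := hfu y hy
    rw [hf, h0, inner_zero_left] at h1 hfx
    linarith
  -- This point of the ball lies farthest from `D` in the separating direction: `f` has dropped by
  -- `r * ‖v‖`, too much to be recovered within distance `r` and still exceed `f x`.
  have hw : x - (r / ‖v‖) • v ∈ C := by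
    apply hC
    rw [mem_closedBall, dist_eq_norm, sub_sub_cancel_left, norm_neg, norm_smul, Real.norm_eq_abs,
      abs_of_pos (by positivity), div_mul_cancel₀ _ hv0.ne']
  obtain ⟨z, hz, hd⟩ := exists_mem_dist_le C D hw
  have h1 : f z = f (x - (r / ‖v‖) • v) - inner ℝ v (x - (r / ‖v‖) • v - z) := by
    rw [hf, hf, inner_sub_right v _ z]; ring
  have h2 : f (x - (r / ‖v‖) • v) = f x - r * ‖v‖ := by
    rw [map_sub, map_smul, hf v, real_inner_self_eq_norm_sq, smul_eq_mul]
    field_simp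
  have h3 : |inner ℝ v (x - (r / ‖v‖) • v - z)| ≤ ‖v‖ * r :=
    (abs_real_inner_le_norm _ _).trans
      (mul_le_mul_of_nonneg_left ((dist_eq_norm _ z ▸ hd).trans hr.le) hv0.le)
  have h4 := neg_le_of_abs_le h3
  have h5 := hfu z hz
  linarith

theorem eventually_subset_of_isCompact_subset_interior [CompleteSpace E] {C : ConvexBody E}
    {Q : Set E} (hQ : IsCompact Q) (h : Q ⊆ interior (C : Set E)) :
    ∀ᶠ D : ConvexBody E in 𝓝 C, Q ⊆ interior (D : Set E) := by
  obtain ⟨δ, hδ, hsub⟩ := hQ.exists_cthickening_subset_open isOpen_interior h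
  filter_upwards [ball_mem_nhds C (half_pos hδ)] with D hD x hx
  rw [mem_ball, dist_comm] at hD
  refine interior_maximal ?_ isOpen_ball (mem_ball_self (half_pos hδ) : x ∈ ball x (δ / 2))
  intro y hy
  refine mem_of_closedBall_subset (r := δ / 2) (fun z hz => interior_subset (hsub ?_)) hD
  refine mem_cthickening_of_dist_le z x δ Q hx ?_
  rw [mem_ball] at hy
  rw [mem_closedBall] at hz
  linarith [dist_triangle z y x]

theorem eventually_mem_interior [CompleteSpace E] {X : Type*} [TopologicalSpace X] {C : X → ConvexBody E}
    {g : X → E} {a : X} (hC : ContinuousAt C a) (hg : ContinuousAt g a)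
    (h : g a ∈ interior (C a : Set E)) :
    ∀ᶠ b in 𝓝 a, g b ∈ interior (C b : Set E) := by
  obtain ⟨r, hr, hsub⟩ := nhds_basis_ball.mem_iff.1 (isOpen_interior.mem_nhds h)
  -- One third each for the motion of `g b`, for a neighbourhood of `g b`, and for the ball required
  -- by `mem_of_closedBall_subset`.
  have hr3 : 0 < r / 3 := by positivity
  filter_upwards [hC (ball_mem_nhds _ hr3), hg (ball_mem_nhds _ hr3)] with b hCb hgb
  rw [mem_preimage, mem_ball, dist_comm] at hCb
  refine interior_maximal ?_ isOpen_ball (mem_ball_self hr3 : g b ∈ ball (g b) (r / 3))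
  intro y hy
  refine mem_of_closedBall_subset (r := r / 3) (fun z hz => interior_subset (hsub ?_)) hCb
  rw [mem_preimage, mem_ball] at hgb
  rw [mem_ball] at hy ⊢
  rw [mem_closedBall] at hz
  linarith [dist_triangle z y (g a), dist_triangle y (g b) (g a)]

theorem eventually_notMem {C : ConvexBody E} {x : E} (h : x ∉ C) : ∀ᶠ D in 𝓝 C, x ∉ D := by
  have hpos : 0 < infDist x (C : Set E) :=
    (C.isClosed.notMem_iff_infDist_pos C.nonempty).1 h
  filter_upwards [ball_mem_nhds C hpos] with D hD hx
  obtain ⟨y, hy, hd⟩ := exists_mem_dist_le D C hx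
  have := infDist_le_dist_of_mem (x := x) hy
  rw [mem_ball] at hD
  linarith

theorem exists_eventually_subset_closedBall (C : ConvexBody E) :
    ∃ R : ℝ, 0 ≤ R ∧ ∀ᶠ D : ConvexBody E in 𝓝 C, (D : Set E) ⊆ closedBall 0 R := by
  obtain ⟨R, hR, h⟩ := C.isBounded.exists_pos_norm_le
  refine ⟨R + 1, by positivity, ?_⟩
  filter_upwards [ball_mem_nhds C one_pos] with D hD x hx
  obtain ⟨y, hy, hd⟩ := exists_mem_dist_le D C hx
  rw [mem_ball] at hD
  rw [mem_closedBall, dist_zero_right]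
  have h1 := h y hy
  have h2 : ‖x‖ ≤ ‖y‖ + ‖x - y‖ := by simpa using norm_add_le y (x - y)
  rw [dist_eq_norm] at hd
  linarith

/-- The affine map `x ↦ A x + b` encoded by the pair `(b, A)`. -/
def affineEval (T : E × (E →L[ℝ] E)) (x : E) : E := T.2 x + T.1

theorem affineEval_def (T : E × (E →L[ℝ] E)) (x : E) : affineEval T x = T.2 x + T.1 := rfl

theorem continuous_affineEval (T : E × (E →L[ℝ] E)) : Continuous (affineEval T) := by
  unfold affineEval; fun_prop

theorem continuous_affineEval_param (x : E) :
    Continuous fun T : E × (E →L[ℝ] E) => affineEval T x := by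
  unfold affineEval; fun_prop

theorem affineEval_eq_toAffineMap (T : E × (E →L[ℝ] E)) :
    affineEval T = ⇑(T.2.toLinearMap.toAffineMap + AffineMap.const ℝ E T.1) := by
  ext x; simp [affineEval]

/-- The image of a convex body under a possibly singular affine map. -/
def affineImage (T : E × (E →L[ℝ] E)) (C : ConvexBody E) : ConvexBody E where
  carrier := affineEval T '' C
  convex' := by
    rw [affineEval_eq_toAffineMap]
    exact C.convex.affine_image _
  isCompact' := C.isCompact.image (continuous_affineEval T)
  nonempty' := C.nonempty.image _

theorem coe_affineImage (T : E × (E →L[ℝ] E)) (C : ConvexBody E) :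
    (affineImage T C : Set E) = affineEval T '' C := rfl

theorem mem_affineImage {T : E × (E →L[ℝ] E)} {C : ConvexBody E} {x : E} (h : x ∈ C) :
    affineEval T x ∈ affineImage T C := mem_image_of_mem _ h

theorem dist_affineEval_le (T : E × (E →L[ℝ] E)) (x y : E) :
    dist (affineEval T x) (affineEval T y) ≤ ‖T.2‖ * dist x y := by
  rw [affineEval, affineEval, dist_add_right]
  exact T.2.dist_le_opNorm x y

theorem continuous_affineImage (T : E × (E →L[ℝ] E)) :
    Continuous (affineImage T) := by
  refine (LipschitzWith.of_dist_le_mul (K := ‖T.2‖₊) fun C D => ?_).continuous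
  have key : ∀ C D : ConvexBody E, ∀ x ∈ affineImage T C, ∃ y ∈ affineImage T D,
      dist x y ≤ ‖T.2‖ * dist C D := by
    rintro C D _ ⟨x, hx, rfl⟩
    obtain ⟨y, hy, hd⟩ := exists_mem_dist_le C D hx
    exact ⟨_, mem_affineImage hy, (dist_affineEval_le T x y).trans (by gcongr)⟩
  exact dist_le_of_mem_dist (by positivity) (key C D) (by rw [dist_comm C D]; exact key D C)

theorem continuous_affineImage_param (C : ConvexBody E) :
    Continuous fun T : E × (E →L[ℝ] E) => affineImage T C := by
  obtain ⟨R, hR, h⟩ := C.isBounded.exists_pos_norm_le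
  refine continuous_iff_continuousAt.2 fun T => ?_
  rw [ContinuousAt, tendsto_iff_dist_tendsto_zero]
  have key : ∀ S S' : E × (E →L[ℝ] E), ∀ x ∈ affineImage S C, ∃ y ∈ affineImage S' C,
      dist x y ≤ ‖S.2 - S'.2‖ * R + ‖S.1 - S'.1‖ := by
    rintro S S' _ ⟨x, hx, rfl⟩
    refine ⟨_, mem_affineImage hx, ?_⟩
    have h1 : affineEval S x - affineEval S' x = (S.2 - S'.2) x + (S.1 - S'.1) := by
      simp only [affineEval, sub_apply]; abel
    rw [dist_eq_norm, h1]
    refine (norm_add_le _ _).trans ?_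
    gcongr
    exact (ContinuousLinearMap.le_opNorm _ _).trans (by gcongr; exact h x hx)
  refine squeeze_zero (fun _ => dist_nonneg)
    (g := fun S => ‖S.2 - T.2‖ * R + ‖S.1 - T.1‖) (fun S => ?_) ?_
  · refine dist_le_of_mem_dist (by positivity) (key S T) ?_
    simpa only [norm_sub_rev S.2, norm_sub_rev S.1] using key T S
  · have : Continuous fun S : E × (E →L[ℝ] E) => ‖S.2 - T.2‖ * R + ‖S.1 - T.1‖ := by fun_prop
    simpa using this.tendsto T

/-- The affine maps sending `K` into `C`. -/
def mapsInto (K C : ConvexBody E) : Set (E × (E →L[ℝ] E)) :=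
  {T | ∀ x ∈ K, affineEval T x ∈ C}

theorem mapsInto_convex (K C : ConvexBody E) : Convex ℝ (mapsInto K C) := by
  intro S hS T hT a b ha hb hab x hx
  have : affineEval (a • S + b • T) x = a • affineEval S x + b • affineEval T x := by
    simp only [affineEval, Prod.snd_add, Prod.fst_add, Prod.smul_snd, Prod.smul_fst,
      add_apply, smul_apply, smul_add]
    abel
  rw [this]
  exact C.convex (hS x hx) (hT x hx) ha hb hab

theorem mapsInto_isClosed (K C : ConvexBody E) : IsClosed (mapsInto K C) := by
  have : mapsInto K C = ⋂ x ∈ K, (fun T => affineEval T x) ⁻¹' (C : Set E) := by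
    ext T; simp [mapsInto]
  rw [this]
  exact isClosed_biInter fun x _ => C.isClosed.preimage (continuous_affineEval_param x)

/-- Affine maps sending a set with interior points into a given ball form a bounded set. -/
theorem isBounded_affine_maps_closedBall {K : ConvexBody E}
    (hK : (interior (K : Set E)).Nonempty) (R : ℝ) :
    Bornology.IsBounded {T : E × (E →L[ℝ] E) | ∀ x ∈ K, affineEval T x ∈ closedBall (0 : E) R} := by
  obtain ⟨c, hc⟩ := hK
  obtain ⟨r, hr, hsub⟩ := nhds_basis_closedBall.mem_iff.1 (isOpen_interior.mem_nhds hc)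
  refine isBounded_iff_forall_norm_le.2 ⟨max (R + 2 * R / r * ‖c‖) (2 * R / r), fun T hT => ?_⟩
  have hcK : c ∈ K := interior_subset hc
  have h0 : ‖affineEval T c‖ ≤ R := by simpa using hT c hcK
  have hR : 0 ≤ R := (norm_nonneg _).trans h0
  have h2 : ‖T.2‖ ≤ 2 * R / r := by
    refine T.2.opNorm_le_bound (by positivity) fun x => ?_
    rcases eq_or_ne x 0 with rfl | hx
    · simp
    have hx0 : 0 < ‖x‖ := norm_pos_iff.2 hx
    have hy : c + (r / ‖x‖) • x ∈ K := by
      refine interior_subset (hsub ?_)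
      rw [mem_closedBall, dist_eq_norm, add_sub_cancel_left, norm_smul, Real.norm_eq_abs,
        abs_of_pos (by positivity), div_mul_cancel₀ _ hx0.ne']
    have h1 : ‖affineEval T (c + (r / ‖x‖) • x)‖ ≤ R := by simpa using hT _ hy
    have h3 : (r / ‖x‖) • T.2 x = affineEval T (c + (r / ‖x‖) • x) - affineEval T c := by
      simp [affineEval]
    have h4 : r / ‖x‖ * ‖T.2 x‖ ≤ 2 * R := by
      have h5 : ‖(r / ‖x‖) • T.2 x‖ = r / ‖x‖ * ‖T.2 x‖ := by
        rw [norm_smul, Real.norm_eq_abs, abs_of_pos (by positivity)]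
      rw [← h5, h3]
      exact (norm_sub_le _ _).trans (by linarith)
    rw [div_mul_eq_mul_div, div_le_iff₀ hx0] at h4
    rw [div_mul_eq_mul_div, le_div_iff₀ hr]
    linarith
  have h1 : ‖T.1‖ ≤ R + 2 * R / r * ‖c‖ := by
    have : T.1 = affineEval T c - T.2 c := by simp [affineEval]
    rw [this]
    refine (norm_sub_le _ _).trans (add_le_add h0 ((T.2.le_opNorm c).trans ?_))
    gcongr
  exact max_le_max h1 h2

/-- Varying only the translation part of `T` moves `T x` freely in a neighbourhood, which must stay
in `C`. -/
theorem affineEval_mem_interior_of_mem_interior_mapsInto {K C : ConvexBody E}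
    {T : E × (E →L[ℝ] E)} (hT : T ∈ interior (mapsInto K C)) {x : E} (hx : x ∈ K) :
    affineEval T x ∈ interior (C : Set E) := by
  have hcont : Continuous fun y : E => ((y - T.2 x, T.2) : E × (E →L[ℝ] E)) := by fun_prop
  have hopen : IsOpen ((fun y : E => ((y - T.2 x, T.2) : E × (E →L[ℝ] E))) ⁻¹'
      interior (mapsInto K C)) := isOpen_interior.preimage hcont
  refine interior_maximal (fun y hy => ?_) hopen ?_
  · have := interior_subset hy x hx
    simpa [affineEval] using this
  · simpa [affineEval] using hT

/-- An interior `T` sends the compact `K` into the interior of `C`, and an exterior `T` sends some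
point outside the closed `C`; both persist for nearby bodies. This gives convergence of the
indicators off the frontier. -/
theorem mapsInto_eventually_iff [CompleteSpace E] {K C : ConvexBody E} {T : E × (E →L[ℝ] E)}
    (hT : T ∉ frontier (mapsInto K C)) :
    ∀ᶠ D in 𝓝 C, (T ∈ mapsInto K D ↔ T ∈ mapsInto K C) := by
  by_cases h : T ∈ mapsInto K C
  · have hi : T ∈ interior (mapsInto K C) := by
      by_contra hi
      exact hT ⟨subset_closure h, hi⟩
    have hsub : affineEval T '' K ⊆ interior (C : Set E) := by
      rintro _ ⟨x, hx, rfl⟩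
      exact affineEval_mem_interior_of_mem_interior_mapsInto hi hx
    filter_upwards [eventually_subset_of_isCompact_subset_interior
      (K.isCompact.image (continuous_affineEval T)) hsub] with D hD
    exact iff_of_true (fun x hx => interior_subset (hD (mem_image_of_mem _ hx))) h
  · obtain ⟨x, hx, hxC⟩ : ∃ x ∈ K, affineEval T x ∉ C := by
      simpa [mapsInto] using h
    filter_upwards [eventually_notMem hxC] with D hD
    exact iff_of_false (fun h' => hD (h' x hx)) h

/-- Maps close to the constant map onto an interior point of `C` still send `K` into `C`. Hence the
averaging domain has positive measure. -/
theorem mapsInto_interior_nonempty [CompleteSpace E] (K : ConvexBody E) {C : ConvexBody E}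
    (hC : (interior (C : Set E)).Nonempty) : (interior (mapsInto K C)).Nonempty := by
  obtain ⟨c, hc⟩ := hC
  obtain ⟨r, hr, hsub⟩ := nhds_basis_ball.mem_iff.1 (isOpen_interior.mem_nhds hc)
  refine ⟨(c, 0), mem_interior_iff_mem_nhds.2 ?_⟩
  filter_upwards [(continuous_affineImage_param K).continuousAt
    (ball_mem_nhds (affineImage (c, 0) K) hr)] with T hT x hx
  obtain ⟨y, ⟨z, -, rfl⟩, hd⟩ := exists_mem_dist_le _ (affineImage (c, 0) K)
    (mem_affineImage (T := T) hx)
  refine interior_subset (hsub ?_)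
  simp only [affineEval, zero_apply, zero_add] at hd ⊢
  exact hd.trans_lt hT

end Body

/-! ### The affine group, its proper action on bodies, and the continuous selection. -/

section Frame

variable {d : ℕ}

/-- Affine self-maps of `ℝ^d`, encoded as pairs `(b, A)` standing for `x ↦ A x + b`. -/
abbrev AffineParam (d : ℕ) : Type :=
  EuclideanSpace ℝ (Fin d) × (EuclideanSpace ℝ (Fin d) →L[ℝ] EuclideanSpace ℝ (Fin d))

/-- The invertible affine maps. -/
def invertibleParams (d : ℕ) : Set (AffineParam d) := {T | IsUnit T.2}

theorem isOpen_invertibleParams : IsOpen (invertibleParams d) :=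
  Units.isOpen.preimage continuous_snd

open Classical in
/-- The affine equivalence encoded by an invertible pair `(b, A)`; the identity otherwise. -/
noncomputable def frame (T : AffineParam d) :
    EuclideanSpace ℝ (Fin d) ≃ᵃ[ℝ] EuclideanSpace ℝ (Fin d) :=
  if h : IsUnit T.2 then
    ((ContinuousLinearEquiv.unitsEquiv ℝ _ h.unit).toLinearEquiv.toAffineEquiv.trans
      (AffineEquiv.constVAdd ℝ _ T.1))
  else AffineEquiv.refl ℝ _

theorem frame_apply {T : AffineParam d} (hT : T ∈ invertibleParams d)
    (x : EuclideanSpace ℝ (Fin d)) : frame T x = affineEval T x := by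
  have h : IsUnit T.2 := hT
  simp [frame, h, affineEval, add_comm]

/-- The pair encoding an affine equivalence. -/
noncomputable def paramOf (S : EuclideanSpace ℝ (Fin d) ≃ᵃ[ℝ] EuclideanSpace ℝ (Fin d)) :
    AffineParam d :=
  (S 0, S.linear.toContinuousLinearEquiv)

theorem affineEval_paramOf (S : EuclideanSpace ℝ (Fin d) ≃ᵃ[ℝ] EuclideanSpace ℝ (Fin d))
    (x : EuclideanSpace ℝ (Fin d)) : affineEval (paramOf S) x = S x := by
  have := S.map_vadd 0 x
  simp only [vadd_eq_add, add_zero] at this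
  simp [affineEval, paramOf, this]

theorem paramOf_mem (S : EuclideanSpace ℝ (Fin d) ≃ᵃ[ℝ] EuclideanSpace ℝ (Fin d)) :
    paramOf S ∈ invertibleParams d :=
  ((ContinuousLinearEquiv.unitsEquiv ℝ _).symm S.linear.toContinuousLinearEquiv).isUnit

theorem frame_paramOf (S : EuclideanSpace ℝ (Fin d) ≃ᵃ[ℝ] EuclideanSpace ℝ (Fin d)) :
    frame (paramOf S) = S := by
  ext1 x
  rw [frame_apply (paramOf_mem S), affineEval_paramOf]

theorem coe_map_eq_affineImage (S : EuclideanSpace ℝ (Fin d) ≃ᵃ[ℝ] EuclideanSpace ℝ (Fin d))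
    (C : FullBody d) : (C.map S).1 = affineImage (paramOf S) C.1 := by
  refine ConvexBody.ext ?_
  rw [coe_affineImage, funext (affineEval_paramOf S)]
  rfl

theorem coe_map_frame {T : AffineParam d} (hT : T ∈ invertibleParams d) (C : FullBody d) :
    (C.map (frame T)).1 = affineImage T C.1 := by
  refine ConvexBody.ext ?_
  rw [coe_affineImage, ← funext (frame_apply hT)]
  rfl

theorem map_trans (S T : EuclideanSpace ℝ (Fin d) ≃ᵃ[ℝ] EuclideanSpace ℝ (Fin d))
    (C : FullBody d) : C.map (S.trans T) = (C.map S).map T := by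
  refine Subtype.ext (ConvexBody.ext ?_)
  change (S.trans T) '' C.toSet = T '' (S '' C.toSet)
  rw [image_image]
  rfl

theorem map_refl (C : FullBody d) : C.map (AffineEquiv.refl ℝ _) = C := by
  refine Subtype.ext (ConvexBody.ext ?_)
  change (fun x => x) '' C.toSet = C.toSet
  exact image_id' _

theorem interior_toSet_map (S : EuclideanSpace ℝ (Fin d) ≃ᵃ[ℝ] EuclideanSpace ℝ (Fin d))
    (C : FullBody d) {x : EuclideanSpace ℝ (Fin d)} (hx : x ∈ interior C.toSet) :
    S x ∈ interior (C.map S).toSet := by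
  refine interior_maximal (t := S.symm ⁻¹' interior C.toSet) ?_
    (isOpen_interior.preimage (continuous_affineEquiv S.symm)) ?_
  · intro y hy
    exact ⟨S.symm y, interior_subset hy, S.apply_symm_apply y⟩
  · rwa [mem_preimage, S.symm_apply_apply]

theorem continuous_map (S : EuclideanSpace ℝ (Fin d) ≃ᵃ[ℝ] EuclideanSpace ℝ (Fin d)) :
    Continuous (FullBody.map S) := by
  refine continuous_induced_rng.2 ?_
  have : (Subtype.val ∘ FullBody.map S) = fun C : FullBody d => affineImage (paramOf S) C.1 :=
    funext (coe_map_eq_affineImage S)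
  rw [this]
  exact (continuous_affineImage _).comp continuous_subtype_val

/-- The inverse of an invertible affine map. -/
noncomputable def paramInv (T : AffineParam d) : AffineParam d :=
  (-(Ring.inverse T.2) T.1, Ring.inverse T.2)

theorem affineEval_paramInv {T : AffineParam d} (hT : T ∈ invertibleParams d)
    (x : EuclideanSpace ℝ (Fin d)) : affineEval (paramInv T) x = (frame T).symm x := by
  apply (frame T).injective
  have h : T.2 * Ring.inverse T.2 = 1 := Ring.mul_inverse_cancel _ hT
  have h' : ∀ y, T.2 (Ring.inverse T.2 y) = y := fun y => by
    rw [← mul_apply_eq_comp, h]; rfl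
  rw [AffineEquiv.apply_symm_apply, frame_apply hT]
  simp [affineEval, paramInv, h']

theorem continuousAt_map_frame_symm {T : AffineParam d} (hT : T ∈ invertibleParams d)
    (C : FullBody d) : ContinuousAt (fun T => C.map (frame T).symm) T := by
  refine Topology.IsInducing.subtypeVal.continuousAt_iff.2 ?_
  have hev : (fun S : AffineParam d => affineImage (paramInv S) C.1) =ᶠ[𝓝 T]
      Subtype.val ∘ fun S => C.map (frame S).symm := by
    filter_upwards [isOpen_invertibleParams.mem_nhds hT] with S hS
    refine ConvexBody.ext ?_
    rw [coe_affineImage, funext (affineEval_paramInv hS)]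
    rfl
  refine ContinuousAt.congr ?_ hev
  have hinv : ContinuousAt (Ring.inverse : (EuclideanSpace ℝ (Fin d) →L[ℝ] EuclideanSpace ℝ (Fin d))
      → _) T.2 := by
    obtain ⟨u, hu⟩ := hT
    rw [← hu]
    exact NormedRing.inverse_continuousAt u
  have h2 : ContinuousAt (fun S : AffineParam d => Ring.inverse S.2) T :=
    hinv.comp (f := Prod.snd) continuousAt_snd
  have h1 : ContinuousAt (fun S : AffineParam d => -(Ring.inverse S.2) S.1) T :=
    (h2.clm_apply continuousAt_fst).neg
  exact (continuous_affineImage_param C.1).continuousAt.comp (f := paramInv) (h1.prodMk h2)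

/-- The range of the linear part is a subspace with interior points, hence everything. -/
theorem isUnit_of_interior_affineImage {T : AffineParam d}
    {C : ConvexBody (EuclideanSpace ℝ (Fin d))}
    (h : (interior (affineImage T C : Set (EuclideanSpace ℝ (Fin d)))).Nonempty) :
    T ∈ invertibleParams d := by
  have hsurj : LinearMap.range T.2.toLinearMap = ⊤ := by
    refine Submodule.eq_top_of_nonempty_interior' _ ?_
    obtain ⟨x, hx⟩ := h
    refine ⟨x - T.1, interior_maximal
      (t := (fun y => y + T.1) ⁻¹' interior (affineImage T C : Set _)) ?_
      (isOpen_interior.preimage (by fun_prop)) (by simpa using hx)⟩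
    intro y hy
    obtain ⟨z, -, hz⟩ := interior_subset hy
    exact ⟨z, by simpa [affineEval] using hz⟩
  have hinj := LinearMap.ker_eq_bot_iff_range_eq_top.2 hsurj
  exact ((ContinuousLinearEquiv.unitsEquiv ℝ _).symm
    (ContinuousLinearEquiv.ofBijective T.2 hinj hsurj)).isUnit

theorem isCompact_mapsInto_closedBall (K : FullBody d) (R : ℝ) :
    IsCompact {T : AffineParam d | ∀ x ∈ K.1, affineEval T x ∈ closedBall 0 R} := by
  refine isCompact_of_isClosed_isBounded ?_ (isBounded_affine_maps_closedBall K.2 R)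
  have : {T : AffineParam d | ∀ x ∈ K.1, affineEval T x ∈ closedBall 0 R} =
      ⋂ x ∈ K.1, (fun T => affineEval T x) ⁻¹' closedBall 0 R := by
    ext T; simp
  rw [this]
  exact isClosed_biInter fun x _ => isClosed_closedBall.preimage (continuous_affineEval_param x)

/-- The orbit map of a convex body under the affine group. -/
noncomputable def orbitMap (K : FullBody d) (T : invertibleParams d) : FullBody d :=
  K.map (frame T.1)

theorem continuous_orbitMap (K : FullBody d) : Continuous (orbitMap K) := by
  refine continuous_induced_rng.2 ?_
  have : Subtype.val ∘ orbitMap K =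
      fun T : invertibleParams d => affineImage T.1 K.1 := by
    ext1 T
    exact coe_map_frame T.2 K
  rw [this]
  exact (continuous_affineImage_param K.1).comp continuous_subtype_val

/-- The affine group acts properly on full-dimensional convex bodies. -/
theorem isProperMap_orbitMap (K : FullBody d) : IsProperMap (orbitMap K) := by
  refine isProperMap_iff_ultrafilter.2 ⟨continuous_orbitMap K, fun 𝒰 C h => ?_⟩
  obtain ⟨R, -, hR⟩ := exists_eventually_subset_closedBall C.1
  have hval : Tendsto (fun T : invertibleParams d => affineImage T.1 K.1) 𝒰 (𝓝 C.1) := by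
    have := (continuous_subtype_val.tendsto C).comp h
    refine this.congr fun T => coe_map_frame T.2 K
  have hmem : {T : AffineParam d | ∀ x ∈ K.1, affineEval T x ∈ closedBall 0 R} ∈
      𝒰.map Subtype.val := by
    rw [Ultrafilter.mem_map]
    filter_upwards [hval.eventually hR] with T hT x hx
    exact hT (mem_affineImage hx)
  obtain ⟨T, -, hT⟩ := (isCompact_mapsInto_closedBall K R).ultrafilter_le_nhds' _ hmem
  have hlim : Tendsto (fun T : invertibleParams d => affineImage T.1 K.1) 𝒰
      (𝓝 (affineImage T K.1)) :=
    ((continuous_affineImage_param K.1).tendsto T).comp (f := Subtype.val) hT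
  have heq : C.1 = affineImage T K.1 := tendsto_nhds_unique hval hlim
  -- Compactness alone allows a singular limit; it is excluded because the limit body `C` has
  -- interior points.
  have hTu : T ∈ invertibleParams d := isUnit_of_interior_affineImage (heq ▸ C.2)
  refine ⟨⟨T, hTu⟩, Subtype.ext ?_, ?_⟩
  · rw [heq]; exact coe_map_frame hTu K
  · rw [nhds_subtype_eq_comap]
    exact map_le_iff_le_comap.1 hT

/-- A fixed point of the affine symmetries of `K` extends to a continuous choice of points on the
orbit of `K`. -/
theorem exists_continuous_on_orbit {K : FullBody d} {x₀ : EuclideanSpace ℝ (Fin d)}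
    (hx₀ : x₀ ∈ fixedPoints K) :
    ∃ h : C(range (orbitMap K), EuclideanSpace ℝ (Fin d)),
      ∀ T : invertibleParams d, h ⟨orbitMap K T, mem_range_self T⟩ = frame T.1 x₀ := by
  have hquot : Topology.IsQuotientMap (rangeFactorization (orbitMap K)) := by
    refine IsClosedMap.isQuotientMap ?_ ((continuous_orbitMap K).subtype_mk _)
      rangeFactorization_surjective
    intro s hs
    have : rangeFactorization (orbitMap K) '' s =
        Subtype.val ⁻¹' (orbitMap K '' s) := by
      ext ⟨y, hy⟩
      simp [rangeFactorization, Subtype.ext_iff]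
    rw [this]
    exact ((isProperMap_orbitMap K).isClosedMap s hs).preimage continuous_subtype_val
  let q : C(invertibleParams d, range (orbitMap K)) :=
    ⟨rangeFactorization (orbitMap K), hquot.continuous⟩
  have hg : Continuous fun T : invertibleParams d => frame T.1 x₀ := by
    have : (fun T : invertibleParams d => frame T.1 x₀) = fun T => affineEval T.1 x₀ :=
      funext fun T => frame_apply T.2 x₀
    rw [this]
    exact (continuous_affineEval_param x₀).comp continuous_subtype_val
  have hfac : Function.FactorsThrough
      (⟨fun T : invertibleParams d => frame T.1 x₀, hg⟩ : C(invertibleParams d, _)) q := by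
    intro S T hST
    have h1 : K.map (frame S.1) = K.map (frame T.1) := congrArg Subtype.val hST
    -- Two frames giving the same body differ by a symmetry of `K`, which fixes `x₀`.
    have h2 : K.map ((frame S.1).trans (frame T.1).symm) = K := by
      rw [map_trans, h1, ← map_trans, AffineEquiv.self_trans_symm, map_refl]
    have h3 := hx₀ _ h2
    change frame S.1 x₀ = frame T.1 x₀
    rw [AffineEquiv.trans_apply] at h3
    exact (AffineEquiv.symm_apply_eq _).1 h3
  refine ⟨Topology.IsQuotientMap.lift (f := q) hquot _ hfac, fun T => ?_⟩
  exact congrArg (fun g : C(invertibleParams d, _) => g T)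
    (Topology.IsQuotientMap.lift_comp (f := q) hquot _ hfac)

/-- There is a continuous selection of interior points which is equivariant on the orbit of a given
body `K` and takes a prescribed value at `K`. -/
theorem exists_continuous_selection {K : FullBody d} {x₀ : EuclideanSpace ℝ (Fin d)}
    (hx₀ : x₀ ∈ fixedPoints K) (hi : x₀ ∈ interior K.toSet) :
    ∃ f : C(FullBody d, EuclideanSpace ℝ (Fin d)),
      (∀ C, f C ∈ interior C.toSet) ∧
      ∀ T : EuclideanSpace ℝ (Fin d) ≃ᵃ[ℝ] EuclideanSpace ℝ (Fin d), f (K.map T) = T x₀ := by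
  obtain ⟨h, hh⟩ := exists_continuous_on_orbit hx₀
  have hcl : IsClosed (range (orbitMap K)) := (isProperMap_orbitMap K).isClosed_range
  -- Tietze extension; away from the orbit `g` may leave the interior of the body, so it serves only
  -- as a local selection below.
  obtain ⟨g, hg⟩ := h.exists_restrict_eq hcl
  have hgT : ∀ T : invertibleParams d, g (orbitMap K T) = frame T.1 x₀ := fun T => by
    rw [← hh T, ← hg]; rfl
  have horb : ∀ T : EuclideanSpace ℝ (Fin d) ≃ᵃ[ℝ] EuclideanSpace ℝ (Fin d),
      orbitMap K ⟨paramOf T, paramOf_mem T⟩ = K.map T := fun T => by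
    rw [orbitMap, frame_paramOf]
  let t : FullBody d → Set (EuclideanSpace ℝ (Fin d)) := fun C =>
    {x | x ∈ interior C.toSet ∧ (C ∈ range (orbitMap K) → x = g C)}
  obtain ⟨f, hf⟩ : ∃ f : C(FullBody d, EuclideanSpace ℝ (Fin d)), ∀ C, f C ∈ t C := by
    -- The values `t C` are convex, so local selections glue: `g` near the orbit, a constant
    -- interior point on its open complement.
    refine exists_continuous_forall_mem_convex_of_local (fun C => ?_) fun C => ?_
    · intro x hx y hy a b ha hb hab
      refine ⟨C.1.convex.interior hx.1 hy.1 ha hb hab, fun hC => ?_⟩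
      rw [hx.2 hC, hy.2 hC, ← add_smul, hab, one_smul]
    · by_cases hC : C ∈ range (orbitMap K)
      · have hgC : g C ∈ interior (C.1 : Set (EuclideanSpace ℝ (Fin d))) := by
          obtain ⟨T, rfl⟩ := hC
          rw [hgT]
          exact interior_toSet_map _ _ hi
        exact ⟨_, eventually_mem_interior continuous_subtype_val.continuousAt g.continuous.continuousAt
          hgC, g, g.continuous.continuousOn, fun D hD => ⟨hD, fun _ => rfl⟩⟩
      · obtain ⟨x, hx⟩ := C.2
        refine ⟨_, inter_mem (eventually_mem_interior (C := Subtype.val) continuous_subtype_val.continuousAt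
          (continuousAt_const (y := x)) hx) (hcl.isOpen_compl.mem_nhds hC), fun _ => x,
          continuousOn_const, fun D hD => ⟨hD.1, fun hD' => absurd hD' hD.2⟩⟩
  refine ⟨f, fun C => (hf C).1, fun T => ?_⟩
  rw [← horb T, (hf _).2 (mem_range_self _), hgT, frame_paramOf]

end Frame

/-! ### Averaging over affine images of `K`: continuity, interiority, equivariance. -/

section Average

variable {d : ℕ}

/-- A Lebesgue measure on the vector space of affine self-maps of `ℝ^d`. -/
noncomputable def paramMeasure (d : ℕ) : Measure (AffineParam d) := Measure.addHaar

instance : (paramMeasure d).IsAddHaarMeasure := by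
  unfold paramMeasure; infer_instance

/-- On each line `T + t • (0, 1)` the map is singular only when `-t` is an eigenvalue of the linear
part, so for finitely many `t`; Fubini along this direction concludes. -/
theorem ae_mem_invertibleParams : ∀ᵐ T ∂paramMeasure d, T ∈ invertibleParams d := by
  refine ae_mem_of_ae_add_linearMap_mem
    (LinearMap.toSpanSingleton ℝ (AffineParam d) (0, 1)) volume (paramMeasure d)
    isOpen_invertibleParams.measurableSet fun T => ?_
  have hfin : (Neg.neg ⁻¹' {c | Module.End.HasEigenvalue T.2.toLinearMap c} : Set ℝ).Finite :=
    (Module.End.finite_hasEigenvalue T.2.toLinearMap).preimage neg_injective.injOn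
  filter_upwards [compl_mem_ae_iff.2 (hfin.measure_zero volume)] with t ht
  have hker : LinearMap.ker (T.2 + t • (1 : EuclideanSpace ℝ (Fin d) →L[ℝ] _)).toLinearMap = ⊥ := by
    rw [LinearMap.ker_eq_bot']
    intro x hx
    by_contra hx0
    refine ht (Module.End.hasEigenvalue_of_hasEigenvector
      (x := x) ⟨Module.End.mem_eigenspace_iff.2 ?_, hx0⟩)
    have h1 : T.2 x + t • x = 0 := by simpa using hx
    rw [neg_smul]
    exact eq_neg_of_add_eq_zero_left h1
  have hrange := LinearMap.ker_eq_bot_iff_range_eq_top.1 hker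
  have := ((ContinuousLinearEquiv.unitsEquiv ℝ _).symm
    (ContinuousLinearEquiv.ofBijective _ hker hrange)).isUnit
  change IsUnit (T + t • ((0, 1) : AffineParam d)).2
  exact this

/-- The point selected by `f`, transported along the affine frame `T`. -/
noncomputable def transported (f : FullBody d → EuclideanSpace ℝ (Fin d)) (C : FullBody d)
    (T : AffineParam d) : EuclideanSpace ℝ (Fin d) :=
  frame T (f (C.map (frame T).symm))

theorem transported_mem_interior {f : FullBody d → EuclideanSpace ℝ (Fin d)}
    (hf : ∀ C, f C ∈ interior C.toSet) (C : FullBody d) (T : AffineParam d) :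
    transported f C T ∈ interior C.toSet := by
  have h := interior_toSet_map (frame T) _ (hf (C.map (frame T).symm))
  rwa [← map_trans, AffineEquiv.symm_trans_self, map_refl] at h

theorem continuous_transported {f : FullBody d → EuclideanSpace ℝ (Fin d)} (hf : Continuous f)
    (T : AffineParam d) : Continuous fun C => transported f C T :=
  (continuous_affineEquiv _).comp (hf.comp (continuous_map _))

/-- Continuity is available on the open, conull set of invertible maps; the default value of `frame`
elsewhere is irrelevant. -/
theorem aestronglyMeasurable_transported {f : FullBody d → EuclideanSpace ℝ (Fin d)}
    (hf : Continuous f) (C : FullBody d) :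
    AEStronglyMeasurable (transported f C) (paramMeasure d) := by
  have hc : ContinuousOn (transported f C) (invertibleParams d) := by
    refine continuousOn_of_forall_continuousAt fun T hT => ?_
    have h1 : ContinuousAt (fun S => f (C.map (frame S).symm)) T :=
      hf.continuousAt.comp (continuousAt_map_frame_symm hT C)
    have h2 : ContinuousAt (fun S : AffineParam d => S.2 (f (C.map (frame S).symm)) + S.1) T :=
      (continuousAt_snd.clm_apply h1).add continuousAt_fst
    refine h2.congr ?_
    filter_upwards [isOpen_invertibleParams.mem_nhds hT] with S hS
    rw [transported, frame_apply hS, affineEval_def]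
  have := hc.aestronglyMeasurable (μ := paramMeasure d) isOpen_invertibleParams.measurableSet
  rwa [Measure.restrict_eq_self_of_ae_mem ae_mem_invertibleParams] at this

theorem measurableSet_mapsInto (K C : FullBody d) : MeasurableSet (mapsInto K.1 C.1) :=
  (mapsInto_isClosed _ _).measurableSet

theorem mapsInto_subset_closedBall {K C : FullBody d} {R : ℝ} (h : C.toSet ⊆ closedBall 0 R) :
    mapsInto K.1 C.1 ⊆ {T : AffineParam d | ∀ x ∈ K.1, affineEval T x ∈ closedBall 0 R} :=
  fun _ hT x hx => h (hT x hx)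

theorem exists_toSet_eventually_subset (C : FullBody d) :
    ∃ R : ℝ, ∀ᶠ D : FullBody d in 𝓝 C, D.toSet ⊆ closedBall 0 R := by
  obtain ⟨R, -, hR⟩ := exists_eventually_subset_closedBall C.1
  exact ⟨R, (continuous_subtype_val.tendsto C).eventually hR⟩

theorem measure_mapsInto_ne_top (K C : FullBody d) :
    paramMeasure d (mapsInto K.1 C.1) ≠ ⊤ := by
  obtain ⟨R, hR⟩ := exists_toSet_eventually_subset C
  exact measure_ne_top_of_subset (mapsInto_subset_closedBall hR.self_of_nhds)
    (isCompact_mapsInto_closedBall K R).measure_ne_top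

theorem measure_mapsInto_ne_zero (K C : FullBody d) :
    paramMeasure d (mapsInto K.1 C.1) ≠ 0 :=
  ((isOpen_interior.measure_pos _ (mapsInto_interior_nonempty K.1 C.2)).trans_le
    (measure_mono interior_subset)).ne'

/-- Integrals over the affine images of `K` inside `C` depend continuously on `C`. -/
theorem continuous_setIntegral_mapsInto {F : Type*} [NormedAddCommGroup F] [NormedSpace ℝ F]
    (K : FullBody d) {G : FullBody d → AffineParam d → F}
    (hm : ∀ C, AEStronglyMeasurable (G C) (paramMeasure d))
    (hc : ∀ T, Continuous fun C => G C T)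
    (hb : ∀ C, ∃ B : ℝ, ∀ᶠ D in 𝓝 C, ∀ T, ‖G D T‖ ≤ B) :
    Continuous fun C => ∫ T in mapsInto K.1 C.1, G C T ∂paramMeasure d := by
  refine continuous_iff_continuousAt.2 fun C => ?_
  simp only [← integral_indicator (measurableSet_mapsInto K _)]
  obtain ⟨R, hR⟩ := exists_toSet_eventually_subset C
  obtain ⟨B, hB⟩ := hb C
  set Q := {T : AffineParam d | ∀ x ∈ K.1, affineEval T x ∈ closedBall 0 R} with hQ
  have hQc : IsCompact Q := isCompact_mapsInto_closedBall K R
  refine tendsto_integral_filter_of_dominated_convergence (Q.indicator fun _ => B)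
    (Eventually.of_forall fun D => (hm D).indicator (measurableSet_mapsInto K D)) ?_ ?_ ?_
  · filter_upwards [hR, hB] with D hRD hBD
    refine Eventually.of_forall fun T => ?_
    by_cases hT : T ∈ mapsInto K.1 D.1
    · rw [indicator_of_mem hT, indicator_of_mem (mapsInto_subset_closedBall hRD hT)]
      exact hBD T
    · rw [indicator_of_notMem hT, norm_zero]
      exact indicator_nonneg (fun T _ => (norm_nonneg _).trans (hBD T)) T
  · exact (integrable_indicator_iff hQc.measurableSet).2
      (integrableOn_const hQc.measure_ne_top)
  -- The frontier of a convex set is null; off it the indicator is locally constant in the body.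
  · filter_upwards [compl_mem_ae_iff.2 ((mapsInto_convex K.1 C.1).addHaar_frontier
      (paramMeasure d))] with T hT
    have hev := (continuous_subtype_val.tendsto C).eventually (mapsInto_eventually_iff hT)
    by_cases h : T ∈ mapsInto K.1 C.1
    · rw [indicator_of_mem h]
      refine ((hc T).tendsto C).congr' ?_
      filter_upwards [hev] with D hD
      rw [indicator_of_mem (hD.2 h)]
    · rw [indicator_of_notMem h]
      refine tendsto_const_nhds.congr' ?_
      filter_upwards [hev] with D hD
      rw [indicator_of_notMem (mt hD.1 h)]

/-- The average of the transported points over all affine images of `K` contained in `C`. -/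
noncomputable def averagePoint (K : FullBody d) (f : FullBody d → EuclideanSpace ℝ (Fin d))
    (C : FullBody d) : EuclideanSpace ℝ (Fin d) :=
  ⨍ T in mapsInto K.1 C.1, transported f C T ∂paramMeasure d

theorem exists_norm_transported_le {f : FullBody d → EuclideanSpace ℝ (Fin d)}
    (hf : ∀ C, f C ∈ interior C.toSet) (C : FullBody d) :
    ∃ B : ℝ, ∀ᶠ D in 𝓝 C, ∀ T, ‖transported f D T‖ ≤ B := by
  obtain ⟨R, hR⟩ := exists_toSet_eventually_subset C
  refine ⟨R, hR.mono fun D hD T => ?_⟩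
  simpa using hD (interior_subset (transported_mem_interior hf D T))

theorem continuous_averagePoint (K : FullBody d) {f : FullBody d → EuclideanSpace ℝ (Fin d)}
    (hf : Continuous f) (hi : ∀ C, f C ∈ interior C.toSet) :
    Continuous (averagePoint K f) := by
  have h1 : Continuous fun C : FullBody d => (paramMeasure d).real (mapsInto K.1 C.1) := by
    have := continuous_setIntegral_mapsInto K (G := fun _ _ => (1 : ℝ))
      (fun _ => aestronglyMeasurable_const) (fun _ => continuous_const)
      (fun _ => ⟨1, Eventually.of_forall fun _ _ => norm_one.le⟩)
    simpa using this
  have h2 := continuous_setIntegral_mapsInto K (aestronglyMeasurable_transported hf)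
    (continuous_transported hf) (exists_norm_transported_le hi)
  have h3 := (h1.inv₀ fun C => ENNReal.toReal_ne_zero.2
    ⟨measure_mapsInto_ne_zero K C, measure_mapsInto_ne_top K C⟩).smul h2
  refine h3.congr fun C => ?_
  exact (setAverage_eq _ _ _).symm

theorem integrableOn_transported (K : FullBody d) {f : FullBody d → EuclideanSpace ℝ (Fin d)}
    (hf : Continuous f) (hi : ∀ C, f C ∈ interior C.toSet) (C : FullBody d) :
    IntegrableOn (transported f C) (mapsInto K.1 C.1) (paramMeasure d) := by
  obtain ⟨B, hB⟩ := exists_norm_transported_le hi C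
  exact Measure.integrableOn_of_bounded (measure_mapsInto_ne_top K C)
    (aestronglyMeasurable_transported hf C) (Eventually.of_forall hB.self_of_nhds)

theorem setAverage_clm_comp {α F G : Type*} [MeasurableSpace α] [NormedAddCommGroup F]
    [NormedSpace ℝ F] [CompleteSpace F] [NormedAddCommGroup G] [NormedSpace ℝ G] [CompleteSpace G]
    {μ : Measure α} {s : Set α} {g : α → F} (hg : IntegrableOn g s μ) (L : F →L[ℝ] G) :
    ⨍ x in s, L (g x) ∂μ = L (⨍ x in s, g x ∂μ) := by
  rw [setAverage_eq, setAverage_eq, L.integral_comp_comm hg, map_smul]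

/-- Otherwise a functional is strictly smaller on the open convex interior than at the mean, yet
some averaged point reaches at least its mean value. -/
theorem averagePoint_mem_interior (K : FullBody d) {f : FullBody d → EuclideanSpace ℝ (Fin d)}
    (hf : Continuous f) (hi : ∀ C, f C ∈ interior C.toSet) (C : FullBody d) :
    averagePoint K f C ∈ interior C.toSet := by
  by_contra h
  obtain ⟨g, hg⟩ := geometric_hahn_banach_open_point C.1.convex.interior isOpen_interior h
  have hint := integrableOn_transported K hf hi C
  obtain ⟨T, -, hT⟩ := exists_setAverage_le (measure_mapsInto_ne_zero K C)
    (measure_mapsInto_ne_top K C) (g.integrable_comp hint)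
  rw [setAverage_clm_comp hint] at hT
  exact absurd hT (not_le.2 (hg _ (transported_mem_interior hi C T)))

/-- Composition with an affine equivalence on the left, as a linear map up to translation. -/
noncomputable def postcompLinear
    (S : EuclideanSpace ℝ (Fin d) ≃ᵃ[ℝ] EuclideanSpace ℝ (Fin d)) :
    AffineParam d ≃L[ℝ] AffineParam d :=
  S.linear.toContinuousLinearEquiv.prodCongr
    ((ContinuousLinearEquiv.refl ℝ _).arrowCongr S.linear.toContinuousLinearEquiv)

/-- Composition with an affine equivalence on the left. -/
noncomputable def postcomp
    (S : EuclideanSpace ℝ (Fin d) ≃ᵃ[ℝ] EuclideanSpace ℝ (Fin d)) :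
    AffineParam d ≃ₜ AffineParam d :=
  (postcompLinear S).toHomeomorph.trans (Homeomorph.addRight (S 0, 0))

theorem affineEval_postcomp (S : EuclideanSpace ℝ (Fin d) ≃ᵃ[ℝ] EuclideanSpace ℝ (Fin d))
    (T : AffineParam d) (x : EuclideanSpace ℝ (Fin d)) :
    affineEval (postcomp S T) x = S (affineEval T x) := by
  rw [← affineEval_paramOf S]
  simp [affineEval, postcomp, postcompLinear, paramOf, add_assoc]

theorem postcomp_mem (S : EuclideanSpace ℝ (Fin d) ≃ᵃ[ℝ] EuclideanSpace ℝ (Fin d))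
    {T : AffineParam d} (hT : T ∈ invertibleParams d) : postcomp S T ∈ invertibleParams d := by
  have : (postcomp S T).2 = (paramOf S).2 * T.2 := by
    ext1 x
    simp [postcomp, postcompLinear, paramOf]
  change IsUnit (postcomp S T).2
  rw [this]
  exact (paramOf_mem S).mul hT

theorem frame_postcomp (S : EuclideanSpace ℝ (Fin d) ≃ᵃ[ℝ] EuclideanSpace ℝ (Fin d))
    {T : AffineParam d} (hT : T ∈ invertibleParams d) :
    frame (postcomp S T) = (frame T).trans S := by
  ext1 x
  rw [frame_apply (postcomp_mem S hT), affineEval_postcomp, AffineEquiv.trans_apply,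
    frame_apply hT]

/-- Since `(S ∘ T)⁻¹(S(C)) = T⁻¹(C)`, the selection is evaluated at the same body. -/
theorem transported_postcomp (f : FullBody d → EuclideanSpace ℝ (Fin d)) (C : FullBody d)
    (S : EuclideanSpace ℝ (Fin d) ≃ᵃ[ℝ] EuclideanSpace ℝ (Fin d))
    {T : AffineParam d} (hT : T ∈ invertibleParams d) :
    transported f (C.map S) (postcomp S T) = S (transported f C T) := by
  have h : (C.map S).map ((frame T).trans S).symm = C.map (frame T).symm := by
    rw [← map_trans]
    congr 1
    ext1 x
    change (frame T).symm (S.symm (S x)) = _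
    rw [S.symm_apply_apply]
  rw [transported, frame_postcomp S hT, h]
  rfl

theorem preimage_postcomp_mapsInto (K C : FullBody d)
    (S : EuclideanSpace ℝ (Fin d) ≃ᵃ[ℝ] EuclideanSpace ℝ (Fin d)) :
    postcomp S ⁻¹' mapsInto K.1 (C.map S).1 = mapsInto K.1 C.1 := by
  ext T
  refine forall₂_congr fun x _ => ?_
  rw [affineEval_postcomp]
  exact S.injective.mem_set_image

/-- Left composition is a linear automorphism of the parameter space followed by a translation, so
only the determinant matters. -/
theorem exists_map_postcomp_eq_smul
    (S : EuclideanSpace ℝ (Fin d) ≃ᵃ[ℝ] EuclideanSpace ℝ (Fin d)) :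
    ∃ c : ℝ, 0 < c ∧
      (paramMeasure d).map (postcomp S) = ENNReal.ofReal c • paramMeasure d := by
  have hdet : LinearMap.det ((postcompLinear S).toLinearEquiv : AffineParam d →ₗ[ℝ] _) ≠ 0 :=
    (LinearEquiv.isUnit_det' _).ne_zero
  refine ⟨_, abs_pos.2 (inv_ne_zero hdet), ?_⟩
  have h : ⇑(postcomp S) = (fun T => T + (S 0, 0)) ∘
      ((postcompLinear S).toLinearEquiv : AffineParam d →ₗ[ℝ] AffineParam d) := rfl
  rw [h, ← Measure.map_map (measurable_add_const _)
    (LinearMap.continuous_of_finiteDimensional _).measurable,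
    Measure.map_linearMap_addHaar_eq_smul_addHaar _ hdet, Measure.map_smul,
    map_add_right_eq_self]

theorem setAverage_smul_measure {α F : Type*} [MeasurableSpace α] [NormedAddCommGroup F]
    [NormedSpace ℝ F] {μ : Measure α} {s : Set α} (g : α → F) {c : ℝ} (hc : 0 < c) :
    ⨍ x in s, g x ∂(ENNReal.ofReal c • μ) = ⨍ x in s, g x ∂μ := by
  rw [setAverage_eq, setAverage_eq, Measure.restrict_smul, integral_smul_measure,
    measureReal_ennreal_smul_apply, ENNReal.toReal_ofReal hc.le, smul_smul, mul_inv,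
    mul_right_comm, inv_mul_cancel₀ hc.ne', one_mul]

theorem averagePoint_map (K : FullBody d) {f : FullBody d → EuclideanSpace ℝ (Fin d)}
    (hf : Continuous f) (hi : ∀ C, f C ∈ interior C.toSet)
    (S : EuclideanSpace ℝ (Fin d) ≃ᵃ[ℝ] EuclideanSpace ℝ (Fin d)) (C : FullBody d) :
    averagePoint K f (C.map S) = S (averagePoint K f C) := by
  obtain ⟨c, hc, hmap⟩ := exists_map_postcomp_eq_smul S
  have hint := integrableOn_transported K hf hi C
  have hm : (paramMeasure d).real (mapsInto K.1 C.1) ≠ 0 :=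
    ENNReal.toReal_ne_zero.2 ⟨measure_mapsInto_ne_zero K C, measure_mapsInto_ne_top K C⟩
  calc averagePoint K f (C.map S)
      = ⨍ T in mapsInto K.1 (C.map S).1, transported f (C.map S) T
          ∂((paramMeasure d).map (postcomp S)) := by
        rw [hmap, setAverage_smul_measure _ hc, averagePoint]
    _ = ⨍ T in mapsInto K.1 C.1, transported f (C.map S) (postcomp S T) ∂paramMeasure d := by
        have hemb := (postcomp S).measurableEmbedding
        rw [setAverage_eq, setAverage_eq, hemb.setIntegral_map, preimage_postcomp_mapsInto,
          measureReal_def, hemb.map_apply, preimage_postcomp_mapsInto, measureReal_def]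
    -- Splitting `S` into linear part and translation lets it pass through the mean.
    _ = ⨍ T in mapsInto K.1 C.1, ((paramOf S).2 (transported f C T) + S 0) ∂paramMeasure d := by
        rw [setAverage_eq, setAverage_eq]
        congr 1
        refine integral_congr_ae (ae_restrict_of_ae ?_)
        filter_upwards [ae_mem_invertibleParams] with T hT
        rw [transported_postcomp f C S hT, ← affineEval_paramOf S (transported f C T)]
        rfl
    _ = S (averagePoint K f C) := by
        rw [← affineEval_paramOf S (averagePoint K f C), affineEval_def, averagePoint,
          ← setAverage_clm_comp hint, setAverage_eq, setAverage_eq,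
          integral_add ((paramOf S).2.integrable_comp hint)
            (integrableOn_const (measure_mapsInto_ne_top K C)),
          setIntegral_const, smul_add, inv_smul_smul₀ hm]
        rfl

theorem averagePoint_self {K : FullBody d} {f : FullBody d → EuclideanSpace ℝ (Fin d)}
    {x₀ : EuclideanSpace ℝ (Fin d)}
    (h : ∀ T : EuclideanSpace ℝ (Fin d) ≃ᵃ[ℝ] EuclideanSpace ℝ (Fin d), f (K.map T) = T x₀) :
    averagePoint K f K = x₀ := by
  have : transported f K = fun _ => x₀ := by
    ext1 T
    rw [transported, h, AffineEquiv.apply_symm_apply]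
  rw [averagePoint, this,
    setAverage_const (measure_mapsInto_ne_zero K K) (measure_mapsInto_ne_top K K)]

end Average

end AffinePoints

theorem proposition6p1 (d : ℕ) (K : AffinePoints.FullBody d) (x₀ : EuclideanSpace ℝ (Fin d))
    (hx₀ : x₀ ∈ AffinePoints.fixedPoints K ∩ interior K.toSet) :
    ∃ p : AffinePoints.FullBody d → EuclideanSpace ℝ (Fin d),
      AffinePoints.IsProperAffinePoint p ∧ p K = x₀ := by
  obtain ⟨f, hi, hK⟩ := AffinePoints.exists_continuous_selection hx₀.1 hx₀.2
  exact ⟨AffinePoints.averagePoint K f,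
    { continuous := AffinePoints.continuous_averagePoint K f.continuous hi
      map_eq := AffinePoints.averagePoint_map K f.continuous hi
      mem_interior := AffinePoints.averagePoint_mem_interior K f.continuous hi },
    AffinePoints.averagePoint_self hK⟩
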